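/- For $\lambda\ge 0$ the BI-AWGN channel of SNR $\lambda$ takes a bit $b\in\{0,1\}$ to $\pm\sqrt{2\lambda}+\mathcal N(0,1)$ (sign $+$ for $b=0$, $-$ for $b=1$), independently for successive bits, and $$C_{\rm BI-AWGN}(\lambda)=1-\frac1{\sqrt\pi}\int_{-\infty}^{\infty}e^{-(y-\sqrt\lambda)^2}\log_2\bigl(1+e^{-4y\sqrt\lambda}\bigr)\,dy$$ is its capacity. AWGN-WT($\lambda$) is the wiretap channel with binary input whose main channel is noiseless and whose eavesdropper channel is the BI-AWGN channel of SNR $\lambda$. A sequence of wiretap codes (a finite set of $M$ messages, a stochastic encoder into $\{0,1\}^n$, and a decoder for the legitimate receiver) with lengths $n\to\infty$ achieves the rate-equivocation pair $(R,R_e)$ over AWGN-WT($\lambda$) if, for a uniformly distributed message $W$ and the eavesdropper's observation $\mathbf Z$, $\frac1n\log_2 M\to R$, the average probability that the legitimate receiver errs tends to $0$, and $\lim_{n\to\infty}H(W\mid\mathbf Z)/n$ (entropy in bits) exists and is at least $R_e$. The pair is achievable if some code sequence achieves it. Let $\{\mathcal C_1(n)\}$ be a sequence of binary linear codes of dimensions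 $k_n$, with lengths $n$ tending to infinity (not necessarily through all integers), of rate $R_1=\lim k_n/n>0$, and with SNR threshold $\lambda^\star$: the infimum of the $\lambda\ge0$ at which, for a uniformly distributed codeword sent over the BI-AWGN channel of SNR $\lambda$, some sequence of decoders (optimal decoding) has word error probability tending to $0$. This set is assumed to be non-empty, so that the code sequence is good. The average error probability per codeword bit may be used throughout instead of the word error probability. Let $\mathcal C_0(n)=\{0,1\}^n$. The secure nested code $(\mathcal C_0(n),\mathcal C_1(n))$ has the cosets of $\mathcal C_1(n)$ in $\mathcal C_0(n)$ as its messages; a message is sent as a uniformly random word of its coset, and the legitimate receiver determines the coset of the word received. **Theorem.** If $\lambda\ge\lambda^\star$, then the sequence of secure nested codes $\{\mathcal C_0(n),\mathcal C_1(n)\}$ achieves the rate-equivocation pair $$(R,R_e)=\bigl(1-R_1,\;1-C_{\rm BI-AWGN}(\lambda)\bigr)$$ over AWGN-WT($\lambda$); in particular, this pair is achievable. -/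

import Mathlib

open Filter Topology MeasureTheory ProbabilityTheory
open scoped ENNReal

noncomputable section

namespace Wiretap

/-- Binary words of length `n`. -/
abbrev Word (n : ℕ) : Type := Fin n → ZMod 2

/-- Binary linear codes of length `n`. -/
abbrev LinearCode (n : ℕ) : Type := Submodule (ZMod 2) (Word n)

/-- The rate `k / n` of a binary linear `(n, k)` code. -/
def codeRate {n : ℕ} (C : LinearCode n) : ℝ :=
  (Module.finrank (ZMod 2) C : ℝ) / n

/-! ### The binary-input AWGN channel -/

/-- The output law of one use of the BI-AWGN channel of signal-to-noise ratio `snr`: the antipodal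
signal `√(2 snr)` (for the bit `0`) or `-√(2 snr)` (for the bit `1`) plus standard normal noise. -/
def biawgn (snr : ℝ) (b : ZMod 2) : Measure ℝ :=
  gaussianReal (if b = 0 then √(2 * snr) else -√(2 * snr)) 1

/-- The output law of `n` independent uses of the BI-AWGN channel on the input word `x`. -/
def biawgnWord (snr : ℝ) {n : ℕ} (x : Word n) : Measure (Fin n → ℝ) :=
  Measure.pi fun j => biawgn snr (x j)

/-- The capacity (in bits per channel use) of the BI-AWGN channel of signal-to-noise ratio `snr`. -/
def capacityBIAWGN (snr : ℝ) : ℝ :=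
  1 - 1 / √Real.pi *
    ∫ y : ℝ, Real.exp (-(y - √snr) ^ 2) * Real.logb 2 (1 + Real.exp (-4 * y * √snr))

/-! ### Error probabilities and the noise threshold of a code sequence -/

/-- Whether decoding errors are counted per codeword or per codeword bit. -/
inductive ErrorCriterion where
  | word
  | bit

open Classical in
/-- The word error probability of the decoder `D`, for a uniformly distributed codeword of `C` that
is sent over the BI-AWGN channel. -/
def wordErrorProb (snr : ℝ) {n : ℕ} (C : LinearCode n) (D : (Fin n → ℝ) → Word n) : ℝ :=
  (∑ c : C, (biawgnWord snr (c : Word n)).real {z | D z ≠ c}) / Fintype.card C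

open Classical in
/-- The bit error probability of the decoder `D`: the expected fraction of wrong bits, for a
uniformly distributed codeword of `C` that is sent over the BI-AWGN channel. -/
def bitErrorProb (snr : ℝ) {n : ℕ} (C : LinearCode n) (D : (Fin n → ℝ) → Word n) : ℝ :=
  (∑ c : C, (∑ j : Fin n, (biawgnWord snr (c : Word n)).real {z | D z j ≠ (c : Word n) j}) / n) /
    Fintype.card C

/-- The error probability under the given criterion. -/
def decodingErrorProb (crit : ErrorCriterion) (snr : ℝ) {n : ℕ} (C : LinearCode n)
    (D : (Fin n → ℝ) → Word n) : ℝ :=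
  match crit with
  | .word => wordErrorProb snr C D
  | .bit => bitErrorProb snr C D

/-- The code sequence has vanishing error probability over the BI-AWGN channel of signal-to-noise
ratio `snr`, under optimal decoding: some sequence of (measurable) decoders has error probability
tending to zero. For word errors, maximum-likelihood decoding is optimal. -/
def VanishingError (crit : ErrorCriterion) (snr : ℝ) {N : ℕ → ℕ}
    (C : (i : ℕ) → LinearCode (N i)) : Prop :=
  ∃ D : (i : ℕ) → (Fin (N i) → ℝ) → Word (N i),
    (∀ i c, MeasurableSet (D i ⁻¹' {c})) ∧
      Tendsto (fun i => decodingErrorProb crit snr (C i) (D i)) atTop (𝓝 0)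

/-- `thr` is the SNR threshold of the code sequence over BI-AWGN channels: the worst (that is, the
smallest) signal-to-noise ratio with vanishing error probability, as an infimum that need not be
attained. There is no such real number if the error probability vanishes at no `snr`. -/
def IsSNRThreshold (crit : ErrorCriterion) {N : ℕ → ℕ} (C : (i : ℕ) → LinearCode (N i))
    (thr : ℝ) : Prop :=
  IsGLB {snr : ℝ | 0 ≤ snr ∧ VanishingError crit snr C} thr

/-- `C` is a good binary linear code sequence of (positive) rate `R` and SNR threshold `thr` for
BI-AWGN channels. -/
structure IsGoodWithThreshold (crit : ErrorCriterion) {N : ℕ → ℕ}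
    (C : (i : ℕ) → LinearCode (N i)) (R thr : ℝ) : Prop where
  rate_pos : 0 < R
  rate : Tendsto (fun i => codeRate (C i)) atTop (𝓝 R)
  threshold : IsSNRThreshold crit C thr

/-! ### Codes for the type II wiretap channel -/

/-- The conditional entropy `H(W | Z)` in bits of a random variable `W` with finitely many values
given `Z`, where `ν w` is the measure `B ↦ P(W = w, Z ∈ B)`: the mean, over the law `∑ w, ν w` of
`Z`, of the entropy of the posterior probabilities `P(W = w | Z = z)`. -/
def condEntropy {W Z : Type} [Fintype W] [MeasurableSpace Z] (ν : W → Measure Z) : ℝ :=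
  ∫ z, (∑ w, Real.negMulLog (((ν w).rnDeriv (∑ v, ν v) z).toReal)) / Real.log 2 ∂(∑ v, ν v)

/-- A code of length `n` for a binary-input wiretap channel with noiseless main channel: a finite
non-empty set of messages, a stochastic encoder, and a decoder for the legitimate receiver. -/
structure WiretapCode (n : ℕ) where
  Msg : Type
  fintypeMsg : Fintype Msg
  nonemptyMsg : Nonempty Msg
  enc : Msg → PMF (Word n)
  dec : Word n → Msg

attribute [instance] WiretapCode.fintypeMsg WiretapCode.nonemptyMsg

namespace WiretapCode

variable {n : ℕ} (K : WiretapCode n)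

/-- The rate `(log₂ M) / n`, where `M` is the number of messages. -/
def rate : ℝ := Real.logb 2 (Fintype.card K.Msg) / n

open Classical in
/-- The average probability (over uniformly distributed messages) that the legitimate receiver, who
observes the sent word without noise, decodes to a wrong message. -/
def errorProb : ℝ :=
  (∑ w : K.Msg, ∑ x : Word n, if K.dec x = w then 0 else (K.enc w x).toReal) / Fintype.card K.Msg

/-- The joint law of a uniformly distributed message `W` and of the observation `Z` of the
eavesdropper over the BI-AWGN channel: `B ↦ P(W = w, Z ∈ B)`. -/
def eavesdropperLaw (snr : ℝ) (w : K.Msg) : Measure (Fin n → ℝ) :=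
  (Fintype.card K.Msg : ℝ≥0∞)⁻¹ • ∑ x : Word n, K.enc w x • biawgnWord snr x

/-- The equivocation `H(W | Z)` of the eavesdropper, in bits. -/
def equivocation (snr : ℝ) : ℝ := condEntropy (K.eavesdropperLaw snr)

end WiretapCode

/-- The code sequence `K`, of lengths `N i → ∞`, achieves the rate-equivocation pair `(R, Re)` over
the wiretap channel whose main channel is noiseless and whose eavesdropper channel is the BI-AWGN
channel of signal-to-noise ratio `snr`. -/
structure Achieves (snr : ℝ) {N : ℕ → ℕ} (K : (i : ℕ) → WiretapCode (N i)) (R Re : ℝ) : Prop where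
  length : Tendsto N atTop atTop
  rate : Tendsto (fun i => (K i).rate) atTop (𝓝 R)
  reliable : Tendsto (fun i => (K i).errorProb) atTop (𝓝 0)
  equivocation : ∃ L : ℝ, Tendsto (fun i => (K i).equivocation snr / N i) atTop (𝓝 L) ∧ Re ≤ L

/-- The pair `(R, Re)` is achievable over this wiretap channel. -/
def Achievable (snr R Re : ℝ) : Prop :=
  ∃ (N : ℕ → ℕ) (K : (i : ℕ) → WiretapCode (N i)), Achieves snr K R Re

/-! ### Secure nested codes -/

/-- A nested pair of binary linear codes. -/
structure NestedPair (n : ℕ) where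
  fine : LinearCode n
  coarse : LinearCode n
  le : coarse ≤ fine

namespace NestedPair

variable {n : ℕ} (P : NestedPair n)

/-- The cosets of the coarse code in the fine code. -/
abbrev Coset : Type := P.fine ⧸ P.coarse.submoduleOf P.fine

open Classical in
/-- The words in a given coset. -/
def cosetWords (w : P.Coset) : Finset (Word n) :=
  {x : Word n | ∃ h : x ∈ P.fine, Submodule.Quotient.mk (⟨x, h⟩ : P.fine) = w}

lemma cosetWords_nonempty (w : P.Coset) : (P.cosetWords w).Nonempty := by
  obtain ⟨x, rfl⟩ := Submodule.Quotient.mk_surjective _ w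
  exact ⟨x, by simp [cosetWords]⟩

open Classical in
/-- The secure nested code: the messages are the cosets of the coarse code in the fine code, a
message is encoded as a uniformly random word of its coset, and the legitimate receiver determines
the coset of the received word. -/
def wiretapCode : WiretapCode n where
  Msg := P.Coset
  fintypeMsg := Fintype.ofFinite _
  nonemptyMsg := ⟨0⟩
  enc w := PMF.uniformOfFinset (P.cosetWords w) (P.cosetWords_nonempty w)
  dec y := if h : y ∈ P.fine then Submodule.Quotient.mk (⟨y, h⟩ : P.fine) else 0

end NestedPair

end Wiretap

end

/-!
Write `X` for a uniformly distributed word, `W` for its coset modulo `C₁` and `Z` for the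
eavesdropper's observation at signal-to-noise ratio `snr`. The secure nested code sends exactly such
an `X`, so its equivocation is `H(W | Z)`. Rate and reliability are elementary (`rate_eq`,
`errorProb_eq_zero`); the content is `H(W | Z) / n → 1 - C(snr)`.

Conditional entropy is used only through Gibbs' inequality: it is the smallest cost
`E[-log q(W | Z)]` of a guess `q` of the message from the observation
(`IsPosterior.condEntropy_le_crossEntropy`). For the whole word the posterior is an explicit product
of logistic functions, and `H(X | Z) = n (1 - C(snr))` is computed from it
(`sum_integral_neg_log_wordPosterior`, `bitEntropy_eq`). Since `W` is a function of `X`, this bounds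
`H(W | Z)` from above (`equivocation_le`).

For the lower bound, `H(W | Z) ≥ H(X | Z) - H(X | W, Z)`, and once `W` is known, `X` can be decoded:
subtracting a coset representative and flipping the signs of the observation accordingly turns the
coset into `C₁`. Wherever the bit error probability of `C₁` vanishes, a bitwise Fano inequality
(`wordEntropy_le`) therefore shows that `H(X | W, Z) = o(n)` (`eventually_lt_equivocation`). A small
word error probability implies a small bit error probability, so bit errors are all that matters.

The threshold is an infimum that need not be attained, so the error may fail to vanish at `snr`
itself. It does vanish at values `hi ≥ snr` arbitrarily close to `snr`, because vanishing error
persists when the noise decreases (`VanishingError.mono`). As the channel at `snr` is a degraded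
version of the one at `hi`, the equivocation at `snr` is at least that at `hi`
(`equivocation_anti`), and the capacity is continuous (`continuous_bitEntropy`), so `hi → snr` gives
the bound.
-/

namespace Wiretap

/-! ### Posteriors, and conditional entropy as a minimal cross-entropy -/

/-- `p w` is an everywhere positive version of the posterior probability of the message `w`, where
`ν w` is the measure `B ↦ P(W = w, Z ∈ B)`. -/
structure IsPosterior {W Z : Type} [Fintype W] [MeasurableSpace Z] (ν : W → Measure Z)
    (p : W → Z → ℝ) : Prop where
  meas : ∀ w, Measurable (p w)
  pos : ∀ w z, 0 < p w z
  sum_eq_one : ∀ z, ∑ w, p w z = 1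
  eq_withDensity : ∀ w, ν w = (∑ v, ν v).withDensity fun z => ENNReal.ofReal (p w z)

namespace IsPosterior

variable {W Z : Type} [Fintype W] [MeasurableSpace Z] {ν : W → Measure Z} {p : W → Z → ℝ}

lemma le_one (h : IsPosterior ν p) (w : W) (z : Z) : p w z ≤ 1 := by
  rw [← h.sum_eq_one z]
  exact Finset.single_le_sum (f := fun w => p w z) (fun v _ => (h.pos v z).le) (Finset.mem_univ w)

lemma integral_eq (h : IsPosterior ν p) (w : W) (f : Z → ℝ) :
    ∫ z, f z ∂ν w = ∫ z, p w z * f z ∂(∑ v, ν v) := by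
  conv_lhs => rw [h.eq_withDensity w]
  rw [integral_withDensity_eq_integral_toReal_smul (h.meas w).ennreal_ofReal (by simp)]
  simp [ENNReal.toReal_ofReal (h.pos w _).le]

lemma integrable_iff (h : IsPosterior ν p) (w : W) (f : Z → ℝ) :
    Integrable f (ν w) ↔ Integrable (fun z => p w z * f z) (∑ v, ν v) := by
  conv_lhs => rw [h.eq_withDensity w]
  rw [integrable_withDensity_iff_integrable_smul' (h.meas w).ennreal_ofReal (by simp)]
  simp [ENNReal.toReal_ofReal (h.pos w _).le]

lemma integrable_negMulLog [∀ w, IsFiniteMeasure (ν w)] (h : IsPosterior ν p) (w : W) :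
    Integrable (fun z => p w z * -Real.log (p w z)) (∑ v, ν v) := by
  refine Integrable.of_bound (C := 1)
    ((h.meas w).mul (h.meas w).log.neg).aestronglyMeasurable (ae_of_all _ fun z => ?_)
  have h1 := Real.abs_log_mul_self_lt (p w z) (h.pos w z) (h.le_one w z)
  rw [Real.norm_eq_abs, mul_neg, abs_neg, mul_comm]
  exact h1.le

lemma integrable_log [∀ w, IsFiniteMeasure (ν w)] (h : IsPosterior ν p) (w : W) :
    Integrable (fun z => -Real.log (p w z)) (ν w) :=
  (h.integrable_iff w _).2 (h.integrable_negMulLog w)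

lemma condEntropy_mul_log_two [∀ w, IsFiniteMeasure (ν w)] (h : IsPosterior ν p) :
    condEntropy ν * Real.log 2 = ∑ w, ∫ z, -Real.log (p w z) ∂ν w := by
  have hd : ∀ᵐ z ∂(∑ v, ν v), ∀ w, ((ν w).rnDeriv (∑ v, ν v) z).toReal = p w z := by
    rw [ae_all_iff]
    intro w
    have := Measure.rnDeriv_withDensity (∑ v, ν v) (h.meas w).ennreal_ofReal
    rw [← h.eq_withDensity w] at this
    filter_upwards [this] with z hz
    rw [hz, ENNReal.toReal_ofReal (h.pos w z).le]
  have hc : condEntropy ν =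
      ∫ z, (∑ w, p w z * -Real.log (p w z)) / Real.log 2 ∂(∑ v, ν v) := by
    refine integral_congr_ae ?_
    filter_upwards [hd] with z hz
    simp [hz, Real.negMulLog]
  have h2 : Real.log 2 ≠ 0 := (Real.log_pos one_lt_two).ne'
  rw [hc, integral_div, div_mul_cancel₀ _ h2,
    integral_finsetSum _ fun w _ => h.integrable_negMulLog w]
  exact Finset.sum_congr rfl fun w _ => (h.integral_eq w _).symm

/-- **Gibbs' inequality**: guessing the message with conditional (sub-)probabilities `q` other than
the posterior costs at least the conditional entropy. -/
lemma condEntropy_le_crossEntropy [∀ w, IsFiniteMeasure (ν w)] (h : IsPosterior ν p)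
    {q : W → Z → ℝ} (hq : ∀ w z, 0 < q w z) (hsum : ∀ z, ∑ w, q w z ≤ 1)
    (hint : ∀ w, Integrable (fun z => -Real.log (q w z)) (ν w)) :
    condEntropy ν * Real.log 2 ≤ ∑ w, ∫ z, -Real.log (q w z) ∂ν w := by
  rw [h.condEntropy_mul_log_two]
  simp_rw [h.integral_eq]
  rw [← integral_finsetSum _ fun w _ => h.integrable_negMulLog w,
    ← integral_finsetSum _ fun w _ => (h.integrable_iff w _).1 (hint w)]
  refine integral_mono (integrable_finsetSum _ fun w _ => h.integrable_negMulLog w)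
    (integrable_finsetSum _ fun w _ => (h.integrable_iff w _).1 (hint w)) fun z => ?_
  have key : ∀ w, p w z * -Real.log (p w z) ≤ p w z * -Real.log (q w z) + (q w z - p w z) := by
    intro w
    have hp := h.pos w z
    have h1 := Real.log_le_sub_one_of_pos (div_pos (hq w z) hp)
    rw [Real.log_div (hq w z).ne' hp.ne'] at h1
    have h2 := mul_le_mul_of_nonneg_left h1 hp.le
    have h3 : p w z * (q w z / p w z - 1) = q w z - p w z := by field_simp
    linarith
  calc ∑ w, p w z * -Real.log (p w z)
      ≤ ∑ w, (p w z * -Real.log (q w z) + (q w z - p w z)) := Finset.sum_le_sum fun w _ => key w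
    _ = ∑ w, p w z * -Real.log (q w z) + (∑ w, q w z - 1) := by
        rw [Finset.sum_add_distrib, Finset.sum_sub_distrib, h.sum_eq_one]
    _ ≤ ∑ w, p w z * -Real.log (q w z) := by linarith [hsum z]

/-- An independent additional observation does not change the posterior. -/
lemma prod [∀ w, IsFiniteMeasure (ν w)] (h : IsPosterior ν p) {G : Type} [MeasurableSpace G]
    (γ : Measure G) [IsProbabilityMeasure γ] :
    IsPosterior (fun w => (ν w).prod γ) fun w z => p w z.1 where
  meas w := (h.meas w).comp measurable_fst
  pos w z := h.pos w z.1
  sum_eq_one z := h.sum_eq_one z.1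
  eq_withDensity w := by
    have hs : ∑ v, (ν v).prod γ = (∑ v, ν v).prod γ := by
      ext s hs
      simp [Measure.prod_apply hs]
    rw [hs]
    conv_lhs => rw [h.eq_withDensity w]
    exact prod_withDensity_left (h.meas w).ennreal_ofReal

/-- The posterior of a function of the message. -/
lemma comp {W' : Type} [Fintype W'] [DecidableEq W'] (h : IsPosterior ν p) {f : W → W'}
    (hf : Function.Surjective f) :
    IsPosterior (fun v => ∑ w with f w = v, ν w) fun v z => ∑ w with f w = v, p w z where
  meas v := Finset.measurable_sum _ fun w _ => h.meas w
  pos v z := by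
    obtain ⟨w, rfl⟩ := hf v
    exact Finset.sum_pos (fun v _ => h.pos v z) ⟨w, by simp⟩
  sum_eq_one z := by
    rw [Finset.sum_fiberwise Finset.univ f]
    exact h.sum_eq_one z
  eq_withDensity v := by
    rw [Finset.sum_fiberwise Finset.univ f]
    ext s hs
    simp only [Measure.finsetSum_apply]
    rw [withDensity_apply _ hs]
    simp_rw [ENNReal.ofReal_sum_of_nonneg fun w _ => (h.pos w _).le]
    rw [lintegral_finsetSum _ fun w _ => (h.meas w).ennreal_ofReal]
    refine Finset.sum_congr rfl fun w _ => ?_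
    rw [← withDensity_apply _ hs, ← h.eq_withDensity w]

/-- The conditional entropy of a function of the message, as a sum over the messages themselves. -/
lemma condEntropy_comp_mul_log_two [∀ w, IsFiniteMeasure (ν w)] (h : IsPosterior ν p)
    {W' : Type} [Fintype W'] [DecidableEq W'] {f : W → W'} (hf : Function.Surjective f) :
    (∀ w, Integrable (fun z => -Real.log (∑ v with f v = f w, p v z)) (ν w)) ∧
    condEntropy (fun v => ∑ w with f w = v, ν w) * Real.log 2 =
      ∑ w, ∫ z, -Real.log (∑ v with f v = f w, p v z) ∂ν w := by
  have hfin : ∀ v, IsFiniteMeasure (∑ w with f w = v, ν w) := fun v => inferInstance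
  have hint : ∀ w', ∀ w ∈ Finset.univ.filter (fun w => f w = w'),
      Integrable (fun z => -Real.log (∑ v with f v = w', p v z)) (ν w) := fun w' =>
    integrable_finsetSum_measure.1 ((h.comp hf).integrable_log w')
  refine ⟨fun w => hint (f w) w (by simp), ?_⟩
  rw [(h.comp hf).condEntropy_mul_log_two,
    ← Finset.sum_fiberwise Finset.univ f fun w =>
      ∫ z, -Real.log (∑ v with f v = f w, p v z) ∂ν w]
  refine Finset.sum_congr rfl fun w' _ => ?_
  rw [integral_finsetSum_measure (hint w')]
  refine Finset.sum_congr rfl fun w hw => ?_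
  rw [(Finset.mem_filter.1 hw).2]

/-- A function of the message has at most the conditional entropy of the message. -/
lemma condEntropy_comp_le [∀ w, IsFiniteMeasure (ν w)] (h : IsPosterior ν p)
    {W' : Type} [Fintype W'] [DecidableEq W'] {f : W → W'} (hf : Function.Surjective f) :
    condEntropy (fun v => ∑ w with f w = v, ν w) ≤ condEntropy ν := by
  obtain ⟨hint, heq⟩ := h.condEntropy_comp_mul_log_two hf
  refine le_of_mul_le_mul_right ?_ (Real.log_pos one_lt_two)
  rw [heq, h.condEntropy_mul_log_two]
  refine Finset.sum_le_sum fun w _ =>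
    integral_mono (hint w) (h.integrable_log w) fun z => neg_le_neg ?_
  exact Real.log_le_log (h.pos w z) (Finset.single_le_sum (f := fun w => p w z)
    (fun v _ => (h.pos v z).le) (by simp))

/-- The inequality `H(W | Z) ≤ H(f W | Z) + H(W | f W, Z)`, with the last term replaced by the cost
of guessing `W` from `f W` and `Z` with conditional (sub-)probabilities `r`. -/
lemma condEntropy_le_comp_add [∀ w, IsFiniteMeasure (ν w)] (h : IsPosterior ν p)
    {W' : Type} [Fintype W'] [DecidableEq W'] {f : W → W'} (hf : Function.Surjective f)
    {r : W → Z → ℝ} (hr : ∀ w z, 0 < r w z) (hsum : ∀ v z, ∑ w with f w = v, r w z ≤ 1)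
    (hrint : ∀ w, Integrable (fun z => -Real.log (r w z)) (ν w)) :
    condEntropy ν * Real.log 2 ≤ condEntropy (fun v => ∑ w with f w = v, ν w) * Real.log 2 +
      ∑ w, ∫ z, -Real.log (r w z) ∂ν w := by
  obtain ⟨hint, heq⟩ := h.condEntropy_comp_mul_log_two hf
  have hpos : ∀ w z, 0 < ∑ v with f v = f w, p v z := fun w z => (h.comp hf).pos (f w) z
  have hlog : ∀ w, (fun z => -Real.log ((∑ v with f v = f w, p v z) * r w z)) =
      fun z => -Real.log (∑ v with f v = f w, p v z) + -Real.log (r w z) := fun w => by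
    funext z
    rw [Real.log_mul (hpos w z).ne' (hr w z).ne', neg_add]
  have hG := h.condEntropy_le_crossEntropy
    (q := fun w z => (∑ v with f v = f w, p v z) * r w z)
    (fun w z => mul_pos (hpos w z) (hr w z)) (fun z => ?_)
    (fun w => by rw [hlog w]; exact (hint w).add (hrint w))
  · simp_rw [hlog] at hG
    rw [heq, ← Finset.sum_add_distrib]
    refine hG.trans_eq (Finset.sum_congr rfl fun w _ => integral_add (hint w) (hrint w))
  · rw [← Finset.sum_fiberwise Finset.univ f, ← (h.comp hf).sum_eq_one z]
    refine Finset.sum_le_sum fun v _ => ?_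
    calc ∑ w with f w = v, (∑ v with f v = f w, p v z) * r w z
        = (∑ w with f w = v, p w z) * ∑ w with f w = v, r w z := by
          rw [Finset.mul_sum]
          refine Finset.sum_congr rfl fun w hw => ?_
          rw [(Finset.mem_filter.1 hw).2]
      _ ≤ ∑ w with f w = v, p w z :=
          mul_le_of_le_one_right ((h.comp hf).pos v z).le (hsum v z)

/-- **Data processing**: the conditional entropy given `Z` is at most that given `φ (Z, G)`, where
the noise `G` is independent of the message and of `Z`. -/
lemma condEntropy_le_of_map_prod [∀ w, IsFiniteMeasure (ν w)] (h : IsPosterior ν p)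
    {Y G : Type} [MeasurableSpace Y] [MeasurableSpace G] (γ : Measure G) [IsProbabilityMeasure γ]
    {φ : Z × G → Y} (hφ : Measurable φ) {ν' : W → Measure Y} {p' : W → Y → ℝ}
    (h' : IsPosterior ν' p') (hν' : ∀ w, ν' w = ((ν w).prod γ).map φ) :
    condEntropy ν ≤ condEntropy ν' := by
  have : ∀ w, IsFiniteMeasure (ν' w) := fun w => by rw [hν' w]; infer_instance
  have hfst : condEntropy ν * Real.log 2 =
      condEntropy (fun w => (ν w).prod γ) * Real.log 2 := by
    rw [h.condEntropy_mul_log_two, (h.prod γ).condEntropy_mul_log_two]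
    refine Finset.sum_congr rfl fun w _ => ?_
    have := integral_fun_fst (μ := ν w) (ν := γ) fun z => -Real.log (p w z)
    simpa using this.symm
  -- The posterior after processing is one admissible guess from the unprocessed observation.
  have hle := (h.prod γ).condEntropy_le_crossEntropy (q := fun w z => p' w (φ z))
    (fun w z => h'.pos w _) (fun z => (h'.sum_eq_one _).le) (fun w => by
      have := h'.integrable_log w
      rw [hν' w] at this
      exact this.comp_measurable hφ)
  have hr : ∑ w, ∫ z, -Real.log (p' w (φ z)) ∂(ν w).prod γ = condEntropy ν' * Real.log 2 := by
    rw [h'.condEntropy_mul_log_two]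
    refine Finset.sum_congr rfl fun w _ => ?_
    rw [hν' w, integral_map hφ.aemeasurable (by exact (h'.meas w).log.neg.aestronglyMeasurable)]
  rw [hr, ← hfst] at hle
  exact le_of_mul_le_mul_right hle (Real.log_pos one_lt_two)

end IsPosterior

/-! ### Posteriors of memoryless channels -/

lemma pi_withDensity {ι Z : Type} [Fintype ι] [MeasurableSpace Z] (μ : Measure Z)
    [IsProbabilityMeasure μ] {f : ι → Z → ℝ≥0∞} (hf : ∀ j, Measurable (f j))
    [∀ j, IsFiniteMeasure (μ.withDensity (f j))] :
    Measure.pi (fun j => μ.withDensity (f j)) =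
      (Measure.pi fun _ => μ).withDensity fun z => ∏ j, f j (z j) := by
  refine Measure.pi_eq fun s hs => ?_
  rw [withDensity_apply _ (.univ_pi hs), ← lintegral_indicator (.univ_pi hs)]
  have hmeas : ∀ j, Measurable ((s j).indicator (f j)) := fun j => (hf j).indicator (hs j)
  have hind : ∀ z : ι → Z, (Set.univ.pi s).indicator (fun z => ∏ j, f j (z j)) z =
      ∏ j, (s j).indicator (f j) (z j) := by
    intro z
    by_cases h : z ∈ Set.univ.pi s
    · rw [Set.indicator_of_mem h]
      exact Finset.prod_congr rfl fun j _ => (Set.indicator_of_mem (h j trivial) _).symm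
    · rw [Set.indicator_of_notMem h]
      simp only [Set.mem_univ_pi, not_forall] at h
      obtain ⟨j, hj⟩ := h
      exact (Finset.prod_eq_zero (Finset.mem_univ j) (Set.indicator_of_notMem hj _)).symm
  simp_rw [hind]
  rw [lintegral_prod_eq_prod_lintegral_of_indepFun Finset.univ
    (fun j (z : ι → Z) => (s j).indicator (f j) (z j))
    (iIndepFun_pi (μ := fun _ : ι => μ) fun j => (hmeas j).aemeasurable)
    fun j => (hmeas j).comp (measurable_pi_apply j)]
  refine Finset.prod_congr rfl fun j _ => ?_
  rw [withDensity_apply _ (hs j), ← lintegral_indicator (hs j)]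
  exact (measurePreserving_eval (fun _ : ι => μ) j).lintegral_comp (hmeas j)

/-- For independent symbols sent over independent uses of a channel, the posterior of a word is the
product of the posteriors of its letters. -/
lemma IsPosterior.pi {ι B Z : Type} [Fintype ι] [DecidableEq ι] [Fintype B] [MeasurableSpace Z]
    {ν : B → Measure Z}
    {p : B → Z → ℝ} [∀ b, IsFiniteMeasure (ν b)] [IsProbabilityMeasure (∑ b, ν b)]
    (h : IsPosterior ν p) :
    IsPosterior (fun x : ι → B => Measure.pi fun j => ν (x j))
      fun x z => ∏ j, p (x j) (z j) where
  meas x := Finset.measurable_prod _ fun j _ => (h.meas (x j)).comp (measurable_pi_apply j)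
  pos x z := Finset.prod_pos fun j _ => h.pos _ _
  sum_eq_one z := by
    rw [← Fintype.prod_sum fun j b => p b (z j)]
    simp [h.sum_eq_one]
  eq_withDensity x := by
    have hfin : ∀ b, IsFiniteMeasure
        ((∑ v, ν v).withDensity fun z => ENNReal.ofReal (p b z)) := fun b => by
      rw [← h.eq_withDensity b]; infer_instance
    have hx : ∀ x : ι → B, Measure.pi (fun j => ν (x j)) =
        (Measure.pi fun _ : ι => ∑ v, ν v).withDensity
          fun z => ENNReal.ofReal (∏ j, p (x j) (z j)) := by
      intro x
      have : (fun j => ν (x j)) =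
          fun j => (∑ v, ν v).withDensity fun z => ENNReal.ofReal (p (x j) z) :=
        funext fun j => h.eq_withDensity (x j)
      rw [this, pi_withDensity _ fun j => (h.meas (x j)).ennreal_ofReal]
      simp_rw [ENNReal.ofReal_prod_of_nonneg fun j _ => (h.pos (x j) _).le]
    have hm : ∀ x : ι → B, Measurable fun z : ι → Z => ENNReal.ofReal (∏ j, p (x j) (z j)) :=
      fun x => (Finset.measurable_prod _ fun j _ =>
        (h.meas (x j)).comp (measurable_pi_apply j)).ennreal_ofReal
    have hs : ∑ x : ι → B, Measure.pi (fun j => ν (x j)) = Measure.pi fun _ : ι => ∑ v, ν v := by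
      ext s hs
      simp only [Measure.finsetSum_apply, hx, withDensity_apply _ hs]
      rw [← lintegral_finsetSum _ fun x _ => hm x]
      have h1 : ∀ z : ι → Z, ∑ x : ι → B, ENNReal.ofReal (∏ j, p (x j) (z j)) = 1 := by
        intro z
        rw [← ENNReal.ofReal_sum_of_nonneg
          fun x _ => (Finset.prod_pos fun j _ => h.pos _ _).le,
          ← Fintype.prod_sum fun j b => p b (z j)]
        simp [h.sum_eq_one]
      simp [h1]
    rw [hs]
    exact hx x

/-! ### Posterior and entropy of the BI-AWGN channel -/

instance (snr : ℝ) (b : ZMod 2) : IsProbabilityMeasure (biawgn snr b) := by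
  unfold biawgn; infer_instance

instance (snr : ℝ) {n : ℕ} (x : Word n) : IsProbabilityMeasure (biawgnWord snr x) := by
  unfold biawgnWord; infer_instance

/-- The signal that transmits the bit `b`. -/
noncomputable def signal (snr : ℝ) (b : ZMod 2) : ℝ := if b = 0 then √(2 * snr) else -√(2 * snr)

lemma biawgn_eq (snr : ℝ) (b : ZMod 2) : biawgn snr b = gaussianReal (signal snr b) 1 := rfl

/-- The posterior probability of the uniformly distributed bit `b` when `y` is observed. -/
noncomputable def bitPosterior (snr : ℝ) (b : ZMod 2) (y : ℝ) : ℝ :=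
  (1 + Real.exp (-(2 * signal snr b * y)))⁻¹

/-- The posterior probability of the uniformly distributed word `x` when `z` is observed. -/
noncomputable def wordPosterior (snr : ℝ) {n : ℕ} (x : Word n) (z : Fin n → ℝ) : ℝ :=
  ∏ j, bitPosterior snr (x j) (z j)

/-- The joint law of a uniformly distributed word and of its observation:
`B ↦ P(X = x, Z ∈ B)`. -/
noncomputable def wordLaw (snr : ℝ) {n : ℕ} (x : Word n) : Measure (Fin n → ℝ) :=
  ((2 : ℝ≥0∞) ^ n)⁻¹ • biawgnWord snr x

lemma isFiniteMeasure_smul_inv {Z : Type} [MeasurableSpace Z] (c : ℝ≥0∞) (hc : c ≠ 0)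
    (μ : Measure Z) [IsFiniteMeasure μ] : IsFiniteMeasure (c⁻¹ • μ) :=
  Measure.smul_finite μ (ENNReal.inv_ne_top.2 hc)

instance (snr : ℝ) {n : ℕ} (x : Word n) : IsFiniteMeasure (wordLaw snr x) :=
  isFiniteMeasure_smul_inv _ (by simp) _

instance (snr : ℝ) (b : ZMod 2) : IsFiniteMeasure ((2 : ℝ≥0∞)⁻¹ • biawgn snr b) :=
  isFiniteMeasure_smul_inv _ (by simp) _

lemma sum_zmod_two {M : Type*} [AddCommMonoid M] (f : ZMod 2 → M) : ∑ b, f b = f 0 + f 1 :=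
  Fin.sum_univ_two f

instance (snr : ℝ) : IsProbabilityMeasure (∑ b, (2 : ℝ≥0∞)⁻¹ • biawgn snr b) := by
  refine ⟨?_⟩
  rw [sum_zmod_two]
  simp [ENNReal.inv_two_add_inv_two]

lemma measurable_bitPosterior (snr : ℝ) (b : ZMod 2) : Measurable (bitPosterior snr b) := by
  unfold bitPosterior; fun_prop

lemma signal_one (snr : ℝ) : signal snr 1 = -√(2 * snr) := by simp [signal]

lemma signal_zero (snr : ℝ) : signal snr 0 = √(2 * snr) := by simp [signal]

lemma gaussianPDFReal_eq_bitPosterior_mul (snr : ℝ) (b : ZMod 2) (y : ℝ) :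
    gaussianPDFReal (signal snr b) 1 y = bitPosterior snr b y *
      (gaussianPDFReal (signal snr 0) 1 y + gaussianPDFReal (signal snr 1) 1 y) := by
  have key : ∀ m : ℝ, gaussianPDFReal m 1 y =
      (1 + Real.exp (-(2 * m * y)))⁻¹ * (gaussianPDFReal m 1 y + gaussianPDFReal (-m) 1 y) := by
    intro m
    have h : gaussianPDFReal (-m) 1 y = Real.exp (-(2 * m * y)) * gaussianPDFReal m 1 y := by
      simp only [gaussianPDFReal]
      rw [mul_left_comm, ← Real.exp_add]
      congr 2
      push_cast
      ring
    rw [h]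
    have : (0 : ℝ) < 1 + Real.exp (-(2 * m * y)) := by positivity
    field_simp
  fin_cases b
  · have := key (signal snr 0)
    rwa [signal_zero, ← signal_one, ← signal_zero] at this
  · have := key (signal snr 1)
    have h : -signal snr 1 = signal snr 0 := by rw [signal_one, signal_zero, neg_neg]
    rwa [h, add_comm (gaussianPDFReal (signal snr 1) 1 y)] at this

lemma isPosterior_bitPosterior (snr : ℝ) :
    IsPosterior (fun b => (2 : ℝ≥0∞)⁻¹ • biawgn snr b) (bitPosterior snr) where
  meas := measurable_bitPosterior snr
  pos b y := by unfold bitPosterior; positivity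
  sum_eq_one y := by
    have h := gaussianPDFReal_eq_bitPosterior_mul snr 0 y
    have h' := gaussianPDFReal_eq_bitPosterior_mul snr 1 y
    have h0 := gaussianPDFReal_pos (signal snr 0) 1 y one_ne_zero
    have h1 := gaussianPDFReal_pos (signal snr 1) 1 y one_ne_zero
    rw [sum_zmod_two]
    refine mul_right_cancel₀ (add_pos h0 h1).ne' ?_
    rw [add_mul, ← h, ← h', one_mul]
  eq_withDensity b := by
    have hg : ∀ b, biawgn snr b = volume.withDensity (gaussianPDF (signal snr b) 1) := fun b => by
      rw [biawgn_eq, gaussianReal_of_var_ne_zero _ one_ne_zero]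
    have hm := (measurable_bitPosterior snr b).ennreal_ofReal
    rw [← Finset.smul_sum, withDensity_smul_measure, sum_zmod_two, hg, hg, hg]
    rw [← withDensity_add_left (measurable_gaussianPDF _ _),
      ← withDensity_mul _ ((measurable_gaussianPDF _ _).add (measurable_gaussianPDF _ _)) hm]
    congr 2
    funext y
    simp only [gaussianPDF, Pi.mul_apply, Pi.add_apply]
    rw [← ENNReal.ofReal_add (gaussianPDFReal_nonneg _ _ _) (gaussianPDFReal_nonneg _ _ _),
      mul_comm, ← ENNReal.ofReal_mul (by unfold bitPosterior; positivity),
      ← gaussianPDFReal_eq_bitPosterior_mul]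

lemma wordLaw_eq_pi (snr : ℝ) {n : ℕ} (x : Word n) :
    wordLaw snr x = Measure.pi fun j => (2 : ℝ≥0∞)⁻¹ • biawgn snr (x j) := by
  refine (Measure.pi_eq fun s hs => ?_).symm
  simp [wordLaw, biawgnWord, Finset.prod_mul_distrib, ENNReal.inv_pow]

lemma isPosterior_wordPosterior (snr : ℝ) (n : ℕ) :
    IsPosterior (wordLaw snr (n := n)) (wordPosterior snr) := by
  have h : wordLaw snr (n := n) =
      fun x => Measure.pi fun j => (2 : ℝ≥0∞)⁻¹ • biawgn snr (x j) :=
    funext fun x => wordLaw_eq_pi snr x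
  rw [h]
  exact (isPosterior_bitPosterior snr).pi

/-- The conditional entropy, in nats, of a uniformly distributed bit given its observation. -/
noncomputable def bitEntropy (snr : ℝ) : ℝ :=
  ∫ g, Real.log (1 + Real.exp (-(2 * √(2 * snr) * (√(2 * snr) + g)))) ∂gaussianReal 0 1

lemma integral_neg_log_bitPosterior (snr : ℝ) (b : ZMod 2) :
    ∫ y, -Real.log (bitPosterior snr b y) ∂biawgn snr b = bitEntropy snr := by
  have key : ∀ m : ℝ, ∫ y, Real.log (1 + Real.exp (-(2 * m * y))) ∂gaussianReal m 1 =
      ∫ g, Real.log (1 + Real.exp (-(2 * m * (m + g)))) ∂gaussianReal 0 1 := by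
    intro m
    have h : gaussianReal m 1 = (gaussianReal 0 1).map (m + ·) := by
      rw [gaussianReal_map_const_add, zero_add]
    conv_lhs => rw [h]
    rw [integral_map (by fun_prop) (Measurable.aestronglyMeasurable (by fun_prop))]
  simp only [bitPosterior, Real.log_inv, neg_neg]
  rw [biawgn_eq, key, bitEntropy]
  fin_cases b
  · rfl
  · change ∫ g, Real.log (1 + Real.exp (-(2 * signal snr 1 * (signal snr 1 + g)))) ∂_ = _
    rw [signal_one]
    have h : gaussianReal 0 1 = (gaussianReal 0 1).map (fun g => -g) := by
      rw [gaussianReal_map_neg, neg_zero]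
    conv_lhs => rw [h]
    rw [integral_map (by fun_prop) (Measurable.aestronglyMeasurable (by fun_prop))]
    refine integral_congr_ae (ae_of_all _ fun g => ?_)
    change Real.log _ = Real.log _
    congr 3
    ring

lemma integral_neg_log_wordPosterior (snr : ℝ) {n : ℕ} (x : Word n) :
    ∫ z, -Real.log (wordPosterior snr x z) ∂biawgnWord snr x = n * bitEntropy snr := by
  have hpos : ∀ b y, 0 < bitPosterior snr b y := (isPosterior_bitPosterior snr).pos
  have hint : ∀ b, Integrable (fun y => -Real.log (bitPosterior snr b y)) (biawgn snr b) :=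
    fun b => (integrable_smul_measure (by simp) (by simp)).1
      ((isPosterior_bitPosterior snr).integrable_log b)
  have hmp : ∀ j, MeasurePreserving (Function.eval j) (biawgnWord snr x) (biawgn snr (x j)) :=
    fun j => measurePreserving_eval (fun j => biawgn snr (x j)) j
  have hlog : ∀ z, -Real.log (wordPosterior snr x z) =
      ∑ j, -Real.log (bitPosterior snr (x j) (Function.eval j z)) := fun z => by
    simp [wordPosterior, Real.log_prod fun j _ => (hpos (x j) (z j)).ne']
  simp_rw [hlog]
  rw [integral_finsetSum _ fun j _ => by
    exact (hmp j).integrable_comp_of_integrable (hint (x j))]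
  have hj : ∀ j, ∫ z, -Real.log (bitPosterior snr (x j) (Function.eval j z)) ∂biawgnWord snr x =
      bitEntropy snr := fun j => by
    rw [← integral_neg_log_bitPosterior snr (x j), ← (hmp j).map_eq,
      integral_map (hmp j).aemeasurable
        (by exact (measurable_bitPosterior snr (x j)).log.neg.aestronglyMeasurable)]
  simp [hj]

lemma sum_integral_neg_log_wordPosterior (snr : ℝ) (n : ℕ) :
    ∑ x : Word n, ∫ z, -Real.log (wordPosterior snr x z) ∂wordLaw snr x = n * bitEntropy snr := by
  simp only [wordLaw, integral_smul_measure, integral_neg_log_wordPosterior]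
  simp

lemma bitEntropy_eq (snr : ℝ) :
    bitEntropy snr = (1 - capacityBIAWGN snr) * Real.log 2 := by
  have hlog : Real.log 2 ≠ 0 := (Real.log_pos one_lt_two).ne'
  have h2 : √2 * √2 = (2 : ℝ) := Real.mul_self_sqrt (by norm_num)
  have hs : signal snr 0 = √2 * √snr := by rw [signal_zero, Real.sqrt_mul (by norm_num)]
  set F : ℝ → ℝ := fun y => gaussianPDFReal (signal snr 0) 1 y •
    -Real.log (bitPosterior snr 0 y) with hF
  have hF' : ∀ u, F (√2 * u) = (√2)⁻¹ * (1 / √Real.pi * Real.log 2 *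
      (Real.exp (-(u - √snr) ^ 2) * Real.logb 2 (1 + Real.exp (-4 * u * √snr)))) := by
    intro u
    have e1 : -(√2 * u - √2 * √snr) ^ 2 / 2 = -(u - √snr) ^ 2 := by
      have : (√2 * u - √2 * √snr) ^ 2 = 2 * (u - √snr) ^ 2 := by
        rw [← mul_sub, mul_pow, sq (√2), h2]
      rw [this]; ring
    have e2 : -(2 * (√2 * √snr) * (√2 * u)) = -4 * u * √snr := by
      calc -(2 * (√2 * √snr) * (√2 * u)) = -(2 * (√2 * √2) * √snr * u) := by ring
        _ = -4 * u * √snr := by rw [h2]; ring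
    simp only [hF, gaussianPDFReal, bitPosterior, hs, smul_eq_mul, Real.log_inv, neg_neg,
      NNReal.coe_one, mul_one, e1, e2, Real.logb, Real.sqrt_mul (show (0 : ℝ) ≤ 2 by norm_num)]
    field_simp
  have hsub := Measure.integral_comp_mul_left F (√2)
  simp_rw [hF'] at hsub
  rw [integral_const_mul, integral_const_mul, abs_of_pos (by positivity), smul_eq_mul] at hsub
  have hI := mul_left_cancel₀ (by positivity) hsub
  rw [← integral_neg_log_bitPosterior snr 0, biawgn_eq,
    integral_gaussianReal_eq_integral_smul one_ne_zero, ← hI, capacityBIAWGN]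
  ring

lemma continuous_bitEntropy : Continuous bitEntropy := by
  refine continuous_iff_continuousAt.2 fun snr => ?_
  set M : ℝ := √(2 * snr) + 1
  have hM : ∀ᶠ t in 𝓝 snr, √(2 * t) ≤ M :=
    (show Continuous fun t : ℝ => √(2 * t) by fun_prop).continuousAt.eventually_le_const
      (by simp [M])
  have hg : Integrable (fun g : ℝ => |g|) (gaussianReal 0 1) :=
    ((memLp_id_gaussianReal (μ := 0) (v := 1) 1).integrable le_rfl).abs
  refine continuousAt_of_dominated (bound := fun g => Real.log 2 + 2 * M * (M + |g|))
    (.of_forall fun t => (Measurable.aestronglyMeasurable (by fun_prop))) ?_ ?_ ?_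
  · filter_upwards [hM] with t ht
    refine ae_of_all _ fun g => ?_
    have h0 : 0 ≤ √(2 * t) := Real.sqrt_nonneg _
    have hle : -(2 * √(2 * t) * (√(2 * t) + g)) ≤ 2 * M * (M + |g|) := by
      have h1 : -(√(2 * t) + g) ≤ M + |g| := by linarith [neg_le_abs g]
      calc -(2 * √(2 * t) * (√(2 * t) + g)) = 2 * √(2 * t) * -(√(2 * t) + g) := by ring
        _ ≤ 2 * √(2 * t) * (M + |g|) := by gcongr
        _ ≤ 2 * M * (M + |g|) := by gcongr
    have hR : 0 ≤ 2 * M * (M + |g|) := by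
      have : 0 ≤ M := h0.trans ht
      positivity
    have hexp := Real.exp_pos (-(2 * √(2 * t) * (√(2 * t) + g)))
    rw [Real.norm_eq_abs, abs_of_nonneg (Real.log_nonneg (by linarith))]
    rw [Real.log_le_iff_le_exp (by linarith), Real.exp_add, Real.exp_log two_pos]
    have h1 := Real.exp_le_exp.2 hle
    have h2 := Real.one_le_exp hR
    linarith
  · exact (integrable_const _).add (((integrable_const M).add hg).const_mul (2 * M))
  · refine ae_of_all _ fun g => Continuous.continuousAt ?_
    exact Continuous.log (by fun_prop) fun t => by positivity

/-! ### Degradation and decoding errors -/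

/-- A BI-AWGN channel is a degraded version of every BI-AWGN channel of larger signal-to-noise
ratio: attenuate the output and add independent noise. -/
lemma exists_biawgnWord_eq_map {lo hi : ℝ} (h0 : 0 ≤ lo) (h : lo ≤ hi) :
    ∃ α β : ℝ, ∀ (n : ℕ) (x : Word n), biawgnWord lo x =
      ((biawgnWord hi x).prod (Measure.pi fun _ => gaussianReal 0 1)).map
        fun p j => α * p.1 j + β * p.2 j := by
  -- When `hi = 0`, also `lo = 0`, and the junk value `α = √(0 / 0) = 0` is still correct.
  set α := √(lo / hi)
  have hα1 : lo / hi ≤ 1 := div_le_one_of_le₀ h (h0.trans h)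
  have hα2 : α ^ 2 = lo / hi := Real.sq_sqrt (div_nonneg h0 (h0.trans h))
  set β := √(1 - lo / hi)
  have hβ2 : β ^ 2 = 1 - lo / hi := Real.sq_sqrt (by linarith)
  have hα : α * √(2 * hi) = √(2 * lo) := by
    rw [← Real.sqrt_mul (div_nonneg h0 (h0.trans h))]
    congr 1
    rcases (h0.trans h).eq_or_lt with h' | h'
    · rw [← h'] at h ⊢
      rw [le_antisymm h h0]; simp
    · field_simp
  have hbit : ∀ b, biawgn lo b = ((biawgn hi b).prod (gaussianReal 0 1)).map
      fun p => α * p.1 + β * p.2 := by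
    intro b
    have hsig : signal lo b = α * signal hi b + β * 0 := by
      unfold signal; split_ifs <;> simp only [mul_neg, hα, mul_zero, add_zero]
    have hcomp : (fun p : ℝ × ℝ => α * p.1 + β * p.2) =
        (fun p : ℝ × ℝ => p.1 + p.2) ∘ Prod.map (α * ·) (β * ·) := rfl
    rw [hcomp, ← Measure.map_map (by fun_prop) (by fun_prop),
      ← Measure.map_prod_map _ _ (by fun_prop) (by fun_prop), biawgn_eq, biawgn_eq,
      gaussianReal_map_const_mul, gaussianReal_map_const_mul]
    refine Eq.trans ?_ gaussianReal_conv_gaussianReal.symm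
    rw [hsig]
    congr 1
    ext
    simp [hα2, hβ2]
  refine ⟨α, β, fun n x => ?_⟩
  have hmp := (measurePreserving_arrowProdEquivProdArrow ℝ ℝ (Fin n)
    (fun j => biawgn hi (x j)) fun _ => gaussianReal 0 1).map_eq
  rw [biawgnWord, biawgnWord, ← hmp]
  rw [Measure.map_map (by fun_prop) (MeasurableEquiv.measurable _)]
  simp_rw [hbit]
  exact (Measure.pi_map_pi (f := fun _ (p : ℝ × ℝ) => α * p.1 + β * p.2) fun j => by fun_prop).symm

lemma bitErrorProb_nonneg (snr : ℝ) {n : ℕ} (C : LinearCode n) (D : (Fin n → ℝ) → Word n) :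
    0 ≤ bitErrorProb snr C D := by
  unfold bitErrorProb; positivity

lemma bitErrorProb_le_wordErrorProb (snr : ℝ) {n : ℕ} (C : LinearCode n)
    (D : (Fin n → ℝ) → Word n) : bitErrorProb snr C D ≤ wordErrorProb snr C D := by
  unfold bitErrorProb wordErrorProb
  gcongr with c
  have hj : ∀ j, (biawgnWord snr (c : Word n)).real {z | D z j ≠ (c : Word n) j} ≤
      (biawgnWord snr (c : Word n)).real {z | D z ≠ c} := fun j =>
    measureReal_mono fun z hz h => hz (by rw [h])
  refine div_le_of_le_mul₀ (by positivity) (by positivity) ?_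
  refine (Finset.sum_le_sum fun j _ => hj j).trans_eq ?_
  simp [mul_comm]

lemma VanishingError.bit {crit : ErrorCriterion} {snr : ℝ} {N : ℕ → ℕ}
    {C : (i : ℕ) → LinearCode (N i)} (h : VanishingError crit snr C) :
    VanishingError .bit snr C := by
  obtain ⟨D, hD, hlim⟩ := h
  refine ⟨D, hD, ?_⟩
  cases crit with
  | bit => exact hlim
  | word =>
    exact squeeze_zero (fun i => bitErrorProb_nonneg snr (C i) (D i))
      (fun i => bitErrorProb_le_wordErrorProb snr (C i) (D i)) hlim

/-- More signal power does not hurt: simulate the noisier channel, with the simulated noise fixed to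
a value that is at least as good as the average. -/
lemma exists_bitErrorProb_le {lo hi : ℝ} (h0 : 0 ≤ lo) (h : lo ≤ hi) {n : ℕ} (C : LinearCode n)
    (D : (Fin n → ℝ) → Word n) (hD : ∀ c, MeasurableSet (D ⁻¹' {c})) :
    ∃ D' : (Fin n → ℝ) → Word n, (∀ c, MeasurableSet (D' ⁻¹' {c})) ∧
      bitErrorProb hi C D' ≤ bitErrorProb lo C D := by
  obtain ⟨α, β, hαβ⟩ := exists_biawgnWord_eq_map h0 h
  set φ : (Fin n → ℝ) × (Fin n → ℝ) → Fin n → ℝ := fun p j => α * p.1 j + β * p.2 j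
  have hφ : Measurable φ := by fun_prop
  set γ : Measure (Fin n → ℝ) := Measure.pi fun _ => gaussianReal 0 1
  have hDm : Measurable D := measurable_to_countable' hD
  have hE : ∀ (c : Word n) (j : Fin n), MeasurableSet {z | D z j ≠ c j} := fun c j =>
    hDm (MeasurableSet.of_discrete (s := {y : Word n | y j ≠ c j}))
  have hsec : ∀ (c : Word n) (j : Fin n),
      Measurable fun g => (biawgnWord hi c).real {z | D (φ (z, g)) j ≠ c j} := fun c j =>
    (measurable_measure_prodMk_right (hφ (hE c j))).ennreal_toReal
  have hint : ∀ (c : Word n) (j : Fin n),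
      Integrable (fun g => (biawgnWord hi c).real {z | D (φ (z, g)) j ≠ c j}) γ := fun c j =>
    Integrable.of_bound (C := 1) (hsec c j).aestronglyMeasurable (ae_of_all _ fun g => by
      rw [Real.norm_eq_abs, abs_of_nonneg measureReal_nonneg]; exact measureReal_le_one)
  have hval : ∀ (c : Word n) (j : Fin n),
      ∫ g, (biawgnWord hi c).real {z | D (φ (z, g)) j ≠ c j} ∂γ =
        (biawgnWord lo c).real {z | D z j ≠ c j} := fun c j => by
    rw [hαβ, measureReal_def, Measure.map_apply hφ (hE c j),
      Measure.prod_apply_symm (hφ (hE c j))]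
    exact integral_toReal (measurable_measure_prodMk_right (hφ (hE c j))).aemeasurable
      (ae_of_all _ fun g => measure_lt_top _ _)
  have hint' : Integrable (fun g => bitErrorProb hi C fun z => D (φ (z, g))) γ := by
    unfold bitErrorProb
    refine Integrable.div_const (integrable_finsetSum _ fun c _ => ?_) _
    refine Integrable.div_const (integrable_finsetSum _ fun j _ => ?_) _
    exact hint c j
  obtain ⟨g, hg⟩ := exists_le_integral hint'
  refine ⟨fun z => D (φ (z, g)), fun c => ?_, hg.trans_eq ?_⟩
  · have : Measurable fun z => φ (z, g) := by fun_prop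
    exact this (hD c)
  · unfold bitErrorProb
    rw [integral_div, integral_finsetSum _ fun c _ => by
      exact (integrable_finsetSum _ fun j _ => hint c j).div_const _]
    congr 1
    refine Finset.sum_congr rfl fun c _ => ?_
    rw [integral_div, integral_finsetSum _ fun j _ => by exact hint c j]
    simp_rw [hval]

lemma VanishingError.mono {lo hi : ℝ} (h0 : 0 ≤ lo) (h : lo ≤ hi) {N : ℕ → ℕ}
    {C : (i : ℕ) → LinearCode (N i)} (hC : VanishingError .bit lo C) :
    VanishingError .bit hi C := by
  obtain ⟨D, hD, hlim⟩ := hC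
  choose D' hD' hle using fun i => exists_bitErrorProb_le h0 h (C i) (D i) (hD i)
  exact ⟨D', hD', squeeze_zero (fun i => bitErrorProb_nonneg hi (C i) (D' i)) hle hlim⟩

/-- A Fano inequality: the conditional entropy of a uniformly distributed word, given its
observation and a function `f` of it, is bounded through the expected number of wrong bits of any
decoder that knows the value of `f`. -/
lemma wordEntropy_le (snr : ℝ) {n : ℕ} {W : Type} [Fintype W] [DecidableEq W] {f : Word n → W}
    (hf : Function.Surjective f) (D : W → (Fin n → ℝ) → Word n) (hD : ∀ w, Measurable (D w))
    {ε : ℝ} (h0 : 0 < ε) (h1 : ε < 1) :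
    n * bitEntropy snr ≤ condEntropy (fun v => ∑ x with f x = v, wordLaw snr x) * Real.log 2 +
      (n * -Real.log (1 - ε) +
        -Real.log ε * ∑ x, ∑ j, (wordLaw snr x).real {z | D (f x) z j ≠ x j}) := by
  classical
  have hE : ∀ (x : Word n) (j : Fin n), MeasurableSet {z | D (f x) z j ≠ x j} := fun x j =>
    hD _ (MeasurableSet.of_discrete (s := {y : Word n | y j ≠ x j}))
  have h1' : 0 < 1 - ε := by linarith
  -- Guess bit by bit, with probability `1 - ε` the decoder's bit, and otherwise the other bit.
  set t : Word n → (Fin n → ℝ) → Fin n → ℝ := fun x z j =>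
    if D (f x) z j ≠ x j then ε else 1 - ε
  have ht : ∀ x z j, 0 < t x z j := fun x z j => by
    simp only [t]; split_ifs <;> assumption
  have hlog : ∀ x z, -Real.log (∏ j, t x z j) = ∑ j, -Real.log (t x z j) := fun x z => by
    rw [Real.log_prod fun j _ => (ht x z j).ne', Finset.sum_neg_distrib]
  have htm : ∀ x j, Measurable fun z => t x z j := fun x j =>
    Measurable.ite (hE x j) measurable_const measurable_const
  have htint : ∀ x j, Integrable (fun z => -Real.log (t x z j)) (wordLaw snr x) := fun x j => by
    refine Integrable.of_bound (C := max |Real.log ε| |Real.log (1 - ε)|)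
      (htm x j).log.neg.aestronglyMeasurable (ae_of_all _ fun z => ?_)
    rw [Real.norm_eq_abs, abs_neg]
    simp only [t]
    split_ifs
    · exact le_max_left _ _
    · exact le_max_right _ _
  have hsum : ∀ v z, ∑ x with f x = v, ∏ j, t x z j ≤ 1 := by
    intro v z
    have hb : ∀ d : ZMod 2, ∑ b, (if d ≠ b then ε else 1 - ε) = 1 := fun d => by
      have hd : d = 0 ∨ d = 1 := by revert d; decide
      rw [sum_zmod_two]
      rcases hd with rfl | rfl <;> simp
    calc ∑ x with f x = v, ∏ j, t x z j
        = ∑ x with f x = v, ∏ j, (if D v z j ≠ x j then ε else 1 - ε) := by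
          refine Finset.sum_congr rfl fun x hx => ?_
          simp only [t, (Finset.mem_filter.1 hx).2]
      _ ≤ ∑ x : Word n, ∏ j, (if D v z j ≠ x j then ε else 1 - ε) := by
          refine Finset.sum_le_sum_of_subset_of_nonneg (Finset.filter_subset _ _)
            fun x _ _ => Finset.prod_nonneg fun j _ => ?_
          split_ifs <;> linarith
      _ = 1 := by
          rw [← Fintype.prod_sum fun j b => if D v z j ≠ b then ε else 1 - ε]
          simp only [hb, Finset.prod_const_one]
  have key := (isPosterior_wordPosterior snr n).condEntropy_le_comp_add hf
    (r := fun x z => ∏ j, t x z j) (fun x z => Finset.prod_pos fun j _ => ht x z j) hsum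
    (fun x => by simp_rw [hlog]; exact integrable_finsetSum _ fun j _ => htint x j)
  rw [(isPosterior_wordPosterior snr n).condEntropy_mul_log_two,
    sum_integral_neg_log_wordPosterior] at key
  refine key.trans (add_le_add le_rfl ?_)
  have hxj : ∀ x j, ∫ z, -Real.log (t x z j) ∂wordLaw snr x ≤
      ((2 : ℝ) ^ n)⁻¹ * -Real.log (1 - ε) +
        -Real.log ε * (wordLaw snr x).real {z | D (f x) z j ≠ x j} := by
    intro x j
    have hi : Integrable ({z | D (f x) z j ≠ x j}.indicator fun _ => -Real.log ε)
        (wordLaw snr x) := (integrable_const _).indicator (hE x j)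
    have hle : ∫ z, -Real.log (t x z j) ∂wordLaw snr x ≤ ∫ z, (-Real.log (1 - ε) +
        {z | D (f x) z j ≠ x j}.indicator (fun _ => -Real.log ε) z) ∂wordLaw snr x := by
      refine integral_mono (htint x j) ((integrable_const _).add hi) fun z => ?_
      have hl : Real.log (1 - ε) ≤ 0 := Real.log_nonpos h1'.le (by linarith)
      by_cases hz : D (f x) z j ≠ x j
      · simp [t, hz, hl]
      · simp only [t, if_neg hz]
        simp [hz]
    refine hle.trans_eq ?_
    rw [integral_add (integrable_const _) hi, integral_indicator_const _ (hE x j)]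
    simp [wordLaw, mul_comm]
  have hcard : (Fintype.card (Word n) : ℝ) = 2 ^ n := by simp
  calc ∑ x, ∫ z, -Real.log (∏ j, t x z j) ∂wordLaw snr x
      = ∑ x, ∑ j, ∫ z, -Real.log (t x z j) ∂wordLaw snr x := by
        refine Finset.sum_congr rfl fun x _ => ?_
        simp_rw [hlog]
        exact integral_finsetSum _ fun j _ => htint x j
    _ ≤ ∑ x : Word n, ∑ j, (((2 : ℝ) ^ n)⁻¹ * -Real.log (1 - ε) +
        -Real.log ε * (wordLaw snr x).real {z | D (f x) z j ≠ x j}) :=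
      Finset.sum_le_sum fun x _ => Finset.sum_le_sum fun j _ => hxj x j
    _ = _ := by
      simp only [Finset.sum_add_distrib, Finset.mul_sum, Finset.sum_const, Finset.card_univ,
        nsmul_eq_mul, hcard, Fintype.card_fin]
      congr 1
      field_simp

/-! ### The coset code -/

/-- The nested pair of the full space and the code `C`. -/
abbrev fullPair {n : ℕ} (C : LinearCode n) : NestedPair n := NestedPair.mk ⊤ C le_top

/-- The coset of a word. -/
def coset {n : ℕ} (C : LinearCode n) (x : Word n) : (fullPair C).Coset :=
  Submodule.Quotient.mk ⟨x, Submodule.mem_top⟩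

/-- A representative of a coset. -/
noncomputable def cosetRep {n : ℕ} (C : LinearCode n) (w : (fullPair C).Coset) : Word n :=
  (Quotient.out w : (⊤ : LinearCode n))

lemma coset_cosetRep {n : ℕ} (C : LinearCode n) (w : (fullPair C).Coset) :
    coset C (cosetRep C w) = w :=
  Quotient.out_eq w

lemma coset_surjective {n : ℕ} (C : LinearCode n) : Function.Surjective (coset C) :=
  fun w => ⟨_, coset_cosetRep C w⟩

lemma coset_eq_coset {n : ℕ} (C : LinearCode n) {x y : Word n} :
    coset C x = coset C y ↔ x - y ∈ C := by
  rw [coset, coset, Submodule.Quotient.eq]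
  rfl

/-- Words correspond to pairs of a coset and a codeword. -/
noncomputable def wordEquiv {n : ℕ} (C : LinearCode n) : Word n ≃ (fullPair C).Coset × C where
  toFun x := (coset C x, ⟨x - cosetRep C (coset C x), by
    rw [← coset_eq_coset, coset_cosetRep]⟩)
  invFun p := cosetRep C p.1 + p.2
  left_inv x := by simp
  right_inv p := by
    have h : coset C (cosetRep C p.1 + p.2) = p.1 := by
      conv_rhs => rw [← coset_cosetRep C p.1]
      rw [coset_eq_coset, add_sub_cancel_left]
      exact p.2.2
    ext1
    · exact h
    · ext1
      simp [h]

noncomputable instance {n : ℕ} (C : LinearCode n) : Fintype (fullPair C).Coset :=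
  (fullPair C).wiretapCode.fintypeMsg

open Classical in
lemma card_coset_mul_card {n : ℕ} (C : LinearCode n) :
    Fintype.card (fullPair C).Coset * Fintype.card C = 2 ^ n := by
  rw [← Fintype.card_prod, ← Fintype.card_congr (wordEquiv C)]
  simp

open Classical in
lemma card_filter_coset {n : ℕ} (C : LinearCode n) (w : (fullPair C).Coset) :
    (Finset.univ.filter fun x => coset C x = w).card = Fintype.card C := by
  rw [← Finset.card_univ]
  refine Finset.card_bij' (fun x _ => (wordEquiv C x).2) (fun c _ => (wordEquiv C).symm (w, c))
    (fun _ _ => Finset.mem_univ _) (fun c _ => ?_) (fun x hx => ?_) fun c _ => ?_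
  · have h := (wordEquiv C).apply_symm_apply (w, c)
    exact Finset.mem_filter.2 ⟨Finset.mem_univ _, congrArg Prod.fst h⟩
  · have hw : (wordEquiv C x).1 = w := (Finset.mem_filter.1 hx).2
    rw [← hw]
    exact (wordEquiv C).symm_apply_apply x
  · simp

open Classical in
lemma cosetWords_eq {n : ℕ} (C : LinearCode n) (w : (fullPair C).Coset) :
    (fullPair C).cosetWords w = Finset.univ.filter fun x => coset C x = w := by
  ext x
  rw [NestedPair.cosetWords, Finset.mem_filter, Finset.mem_filter]
  exact and_congr_right fun _ => ⟨fun ⟨_, h⟩ => h, fun h => ⟨Submodule.mem_top, h⟩⟩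

open Classical in
lemma eavesdropperLaw_eq {n : ℕ} (C : LinearCode n) (snr : ℝ) :
    (fullPair C).wiretapCode.eavesdropperLaw snr =
      fun w => ∑ x with coset C x = w, wordLaw snr x := by
  funext w
  have hcard : (Fintype.card (fullPair C).Coset : ℝ≥0∞)⁻¹ * (Fintype.card C : ℝ≥0∞)⁻¹ =
      ((2 : ℝ≥0∞) ^ n)⁻¹ := by
    rw [← ENNReal.mul_inv (by simp) (by simp)]
    exact_mod_cast congrArg (fun k : ℕ => (k : ℝ≥0∞)⁻¹) (card_coset_mul_card C)
  have henc : ∀ (w : (fullPair C).Coset) (x : Word n), (fullPair C).wiretapCode.enc w x =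
      if coset C x = w then (Fintype.card C : ℝ≥0∞)⁻¹ else 0 := fun w x => by
    change PMF.uniformOfFinset ((fullPair C).cosetWords w)
      ((fullPair C).cosetWords_nonempty w) x = _
    rw [PMF.uniformOfFinset_apply]
    simp only [cosetWords_eq, card_filter_coset, Finset.mem_filter, Finset.mem_univ, true_and]
  calc (Fintype.card (fullPair C).Coset : ℝ≥0∞)⁻¹ •
        ∑ x, (fullPair C).wiretapCode.enc w x • biawgnWord snr x
      = (Fintype.card (fullPair C).Coset : ℝ≥0∞)⁻¹ •
        ∑ x, (if coset C x = w then (Fintype.card C : ℝ≥0∞)⁻¹ else 0) • biawgnWord snr x := by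
        congr 1
        exact Finset.sum_congr rfl fun x _ => congrArg (· • biawgnWord snr x) (henc w x)
    _ = ∑ x with coset C x = w, wordLaw snr x := by
        simp only [ite_smul, zero_smul, ← Finset.sum_filter, Finset.smul_sum, wordLaw, smul_smul,
          hcard]

lemma errorProb_eq_zero {n : ℕ} (C : LinearCode n) :
    (fullPair C).wiretapCode.errorProb = 0 := by
  classical
  rw [WiretapCode.errorProb]
  refine div_eq_zero_iff.2 (Or.inl (Finset.sum_eq_zero
    fun (w : (fullPair C).Coset) _ => Finset.sum_eq_zero fun x _ => ?_))
  split_ifs with h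
  · rfl
  · have hx : x ∉ (fullPair C).cosetWords w := fun hx => h <| by
      rw [cosetWords_eq, Finset.mem_filter] at hx
      rw [← hx.2]
      exact dif_pos (show x ∈ (⊤ : LinearCode n) from Submodule.mem_top)
    change ENNReal.toReal (PMF.uniformOfFinset ((fullPair C).cosetWords w)
      ((fullPair C).cosetWords_nonempty w) x) = 0
    rw [PMF.uniformOfFinset_apply, if_neg hx, ENNReal.toReal_zero]

lemma rate_eq {n : ℕ} (hn : 0 < n) (C : LinearCode n) :
    (fullPair C).wiretapCode.rate = 1 - codeRate C := by
  classical
  have h := congrArg (fun k : ℕ => Real.logb 2 k) (card_coset_mul_card C)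
  have hC : Fintype.card C = 2 ^ Module.finrank (ZMod 2) C := by
    rw [Module.card_eq_pow_finrank (K := ZMod 2), ZMod.card]
  have hW : (Fintype.card (fullPair C).Coset : ℝ) ≠ 0 := by
    have := card_coset_mul_card C
    intro h0
    rw [Nat.cast_eq_zero.1 h0, zero_mul] at this
    exact (pow_ne_zero n two_ne_zero) this.symm
  simp only [hC, Nat.cast_mul, Nat.cast_pow, Nat.cast_ofNat] at h
  rw [Real.logb_mul hW (by positivity), Real.logb_pow, Real.logb_pow,
    Real.logb_self_eq_one one_lt_two] at h
  have hn' : (n : ℝ) ≠ 0 := by exact_mod_cast hn.ne'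
  change Real.logb 2 (Fintype.card (fullPair C).Coset) / n = _
  rw [codeRate]
  field_simp
  linarith

/-! ### The equivocation of the coset code -/

/-- Change the signs of the observations at the positions where `u` is not zero. -/
noncomputable def signFlip {n : ℕ} (u : Word n) (z : Fin n → ℝ) (j : Fin n) : ℝ :=
  if u j = 0 then z j else -z j

lemma measurable_signFlip {n : ℕ} (u : Word n) : Measurable (signFlip u) := by
  refine measurable_pi_lambda _ fun j => ?_
  unfold signFlip
  split_ifs <;> fun_prop

/-- The symmetry of the BI-AWGN channel. -/
lemma map_signFlip_biawgnWord (snr : ℝ) {n : ℕ} (x u : Word n) :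
    (biawgnWord snr x).map (signFlip u) = biawgnWord snr (x - u) := by
  have hbit : ∀ b c : ZMod 2, (biawgn snr b).map (fun y => if c = 0 then y else -y) =
      biawgn snr (b - c) := by
    intro b c
    have h01 : ∀ d : ZMod 2, d = 0 ∨ d = 1 := by decide
    rcases h01 c with rfl | rfl
    · simp
    · simp only [one_ne_zero, if_false]
      rw [biawgn_eq, gaussianReal_map_neg, biawgn_eq]
      congr 1
      rcases h01 b with rfl | rfl
      · rw [show (0 : ZMod 2) - 1 = 1 by decide, signal_zero, signal_one]
      · rw [sub_self, signal_zero, signal_one, neg_neg]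
  have hm : ∀ j, Measurable fun y : ℝ => if u j = 0 then y else -y := fun j => by
    split_ifs <;> fun_prop
  rw [biawgnWord, biawgnWord]
  simp_rw [Pi.sub_apply, ← hbit]
  have : ∀ j, SigmaFinite ((biawgn snr (x j)).map fun y => if u j = 0 then y else -y) :=
    fun j => by rw [hbit]; infer_instance
  exact Measure.pi_map_pi (f := fun j (y : ℝ) => if u j = 0 then y else -y)
    fun j => (hm j).aemeasurable

open Classical in
lemma sum_sub_cosetRep {n : ℕ} (C : LinearCode n) (F : Word n → ℝ) :
    ∑ x, F (x - cosetRep C (coset C x)) =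
      Fintype.card (fullPair C).Coset * ∑ c : C, F c := by
  have h := Fintype.sum_equiv (wordEquiv C) (fun x => F (x - cosetRep C (coset C x)))
    (fun p => F p.2) fun x => rfl
  rw [h, Fintype.sum_prod_type]
  simp

/-- A decoder for `C` becomes a decoder for each coset of `C`, with the same average number of
wrong bits. -/
lemma sum_wordLaw_error {n : ℕ} (hn : 0 < n) (C : LinearCode n) (snr : ℝ)
    (D : (Fin n → ℝ) → Word n) (hD : Measurable D) :
    ∑ x, ∑ j, (wordLaw snr x).real {z | (D (signFlip (cosetRep C (coset C x)) z) +
      cosetRep C (coset C x)) j ≠ x j} = n * bitErrorProb snr C D := by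
  classical
  set F : Word n → ℝ := fun c => ∑ j, (biawgnWord snr c).real {z | D z j ≠ c j}
  have hx : ∀ x u : Word n, ∑ j, (wordLaw snr x).real {z | (D (signFlip u z) + u) j ≠ x j} =
      ((2 : ℝ) ^ n)⁻¹ * F (x - u) := by
    intro x u
    simp only [F]
    rw [Finset.mul_sum]
    refine Finset.sum_congr rfl fun j _ => ?_
    have hE : MeasurableSet {z | D z j ≠ (x - u) j} :=
      hD (MeasurableSet.of_discrete (s := {y : Word n | y j ≠ (x - u) j}))
    rw [← map_signFlip_biawgnWord, map_measureReal_apply (measurable_signFlip u) hE, wordLaw,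
      measureReal_ennreal_smul_apply]
    congr 2
    · simp
    · ext z
      simp [eq_sub_iff_add_eq]
  simp_rw [hx]
  rw [← Finset.mul_sum, sum_sub_cosetRep]
  have hcard : (Fintype.card (fullPair C).Coset : ℝ) * Fintype.card C = 2 ^ n := by
    exact_mod_cast card_coset_mul_card C
  have hW : (Fintype.card (fullPair C).Coset : ℝ) ≠ 0 := fun h0 => by
    rw [h0, zero_mul] at hcard
    exact (pow_ne_zero n two_ne_zero) hcard.symm
  have hC : (Fintype.card C : ℝ) ≠ 0 := fun h0 => by
    rw [h0, mul_zero] at hcard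
    exact (pow_ne_zero n two_ne_zero) hcard.symm
  have hn' : (n : ℝ) ≠ 0 := by exact_mod_cast hn.ne'
  have hb : bitErrorProb snr C D = (∑ c : C, F c) / n / Fintype.card C := by
    rw [bitErrorProb, ← Finset.sum_div]
  rw [hb, ← hcard]
  field_simp

lemma equivocation_le {n : ℕ} (C : LinearCode n) (snr : ℝ) :
    (fullPair C).wiretapCode.equivocation snr ≤ n * (1 - capacityBIAWGN snr) := by
  classical
  refine le_of_mul_le_mul_right ?_ (Real.log_pos one_lt_two)
  rw [mul_assoc, ← bitEntropy_eq, ← sum_integral_neg_log_wordPosterior,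
    ← (isPosterior_wordPosterior snr n).condEntropy_mul_log_two, WiretapCode.equivocation,
    eavesdropperLaw_eq]
  exact mul_le_mul_of_nonneg_right ((isPosterior_wordPosterior snr n).condEntropy_comp_le
    (coset_surjective C)) (Real.log_pos one_lt_two).le

lemma le_equivocation {n : ℕ} (hn : 0 < n) (C : LinearCode n) (snr : ℝ)
    (D : (Fin n → ℝ) → Word n) (hD : Measurable D) {ε : ℝ} (h0 : 0 < ε) (h1 : ε < 1) :
    bitEntropy snr + Real.log (1 - ε) + Real.log ε * bitErrorProb snr C D ≤
      (fullPair C).wiretapCode.equivocation snr / n * Real.log 2 := by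
  classical
  have h := wordEntropy_le snr (coset_surjective C)
    (fun w z => D (signFlip (cosetRep C w) z) + cosetRep C w)
    (fun w => (hD.comp (measurable_signFlip _)).add_const _) h0 h1
  rw [sum_wordLaw_error hn C snr D hD, ← eavesdropperLaw_eq C snr] at h
  have hn' : (0 : ℝ) < n := by exact_mod_cast hn
  rw [div_mul_eq_mul_div, le_div_iff₀ hn', WiretapCode.equivocation]
  refine le_trans (le_of_eq ?_) (sub_le_iff_le_add.2 h)
  ring

/-- The eavesdropper's equivocation does not increase with the signal-to-noise ratio. -/
lemma equivocation_anti {lo hi : ℝ} (h0 : 0 ≤ lo) (h : lo ≤ hi) {n : ℕ} (C : LinearCode n) :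
    (fullPair C).wiretapCode.equivocation hi ≤ (fullPair C).wiretapCode.equivocation lo := by
  classical
  obtain ⟨α, β, hαβ⟩ := exists_biawgnWord_eq_map h0 h
  have hmeas : Measurable fun (p : (Fin n → ℝ) × (Fin n → ℝ)) j => α * p.1 j + β * p.2 j := by
    fun_prop
  simp only [WiretapCode.equivocation, eavesdropperLaw_eq]
  have hfin : ∀ v, IsFiniteMeasure (∑ x with coset C x = v, wordLaw hi x) :=
    fun v => inferInstance
  refine ((isPosterior_wordPosterior hi n).comp (coset_surjective C)).condEntropy_le_of_map_prod
    (Measure.pi fun _ : Fin n => gaussianReal 0 1) hmeas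
    ((isPosterior_wordPosterior lo n).comp (coset_surjective C)) fun w => ?_
  ext s hs
  rw [Measure.map_apply hmeas hs, Measure.prod_apply (hmeas hs), lintegral_finsetSum_measure,
    Measure.finsetSum_apply]
  refine Finset.sum_congr rfl fun x _ => ?_
  rw [← Measure.prod_apply (hmeas hs), wordLaw, wordLaw, hαβ, Measure.prod_smul_left,
    Measure.smul_apply, Measure.smul_apply, Measure.map_apply hmeas hs]

/-- At every signal-to-noise ratio with vanishing error, the normalized equivocation is
asymptotically at least the conditional entropy of one channel use (both in nats here). -/
lemma eventually_lt_equivocation {snr : ℝ} {N : ℕ → ℕ} (hN : Tendsto N atTop atTop)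
    {C : (i : ℕ) → LinearCode (N i)} (hC : VanishingError .bit snr C) {a : ℝ}
    (ha : a < bitEntropy snr) :
    ∀ᶠ i in atTop, a < (fullPair (C i)).wiretapCode.equivocation snr / N i * Real.log 2 := by
  obtain ⟨D, hD, hlim⟩ := hC
  have hε : ∃ ε : ℝ, 0 < ε ∧ ε < 1 ∧ a < bitEntropy snr + Real.log (1 - ε) := by
    have hcont : Tendsto (fun ε : ℝ => bitEntropy snr + Real.log (1 - ε)) (𝓝[>] 0)
        (𝓝 (bitEntropy snr)) := by
      have : ContinuousAt (fun ε : ℝ => bitEntropy snr + Real.log (1 - ε)) 0 :=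
        continuousAt_const.add (ContinuousAt.log (by fun_prop) (by norm_num))
      simpa using this.tendsto.mono_left nhdsWithin_le_nhds
    have h1 : ∀ᶠ ε : ℝ in 𝓝[>] 0, ε < 1 := nhdsWithin_le_nhds (eventually_lt_nhds one_pos)
    obtain ⟨ε, ⟨h, h'⟩, h''⟩ := (((hcont.eventually_const_lt ha).and h1).and
      self_mem_nhdsWithin).exists
    exact ⟨ε, h'', h', h⟩
  obtain ⟨ε, h0, h1, hlt⟩ := hε
  have hlim' : Tendsto (fun i => bitEntropy snr + Real.log (1 - ε) +
      Real.log ε * bitErrorProb snr (C i) (D i)) atTop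
      (𝓝 (bitEntropy snr + Real.log (1 - ε) + Real.log ε * 0)) :=
    (Tendsto.const_mul _ hlim).const_add _
  rw [mul_zero, add_zero] at hlim'
  filter_upwards [hlim'.eventually_const_lt hlt, hN.eventually_gt_atTop 0] with i hi hn
  exact hi.trans_le (le_equivocation hn (C i) snr (D i) (measurable_to_countable' (hD i)) h0 h1)

lemma tendsto_equivocation {crit : ErrorCriterion} {N : ℕ → ℕ} (hN : Tendsto N atTop atTop)
    {C : (i : ℕ) → LinearCode (N i)} {thr : ℝ} (hC : IsSNRThreshold crit C thr) {snr : ℝ}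
    (hsnr : thr ≤ snr) :
    Tendsto (fun i => (fullPair (C i)).wiretapCode.equivocation snr / N i) atTop
      (𝓝 (1 - capacityBIAWGN snr)) := by
  have hlog := Real.log_pos one_lt_two
  have h0 : 0 ≤ snr := (hC.2 fun t ht => ht.1 : (0 : ℝ) ≤ thr).trans hsnr
  refine tendsto_order.2 ⟨fun a ha => ?_, fun a ha => ?_⟩
  · have ha' : a * Real.log 2 < bitEntropy snr := by
      rw [bitEntropy_eq]; exact mul_lt_mul_of_pos_right ha hlog
    -- The error need not vanish at `snr = thr` itself, but it does so at some slightly larger `hi`.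
    obtain ⟨δ, hδ, hball⟩ := Metric.eventually_nhds_iff.1
      (continuous_bitEntropy.continuousAt.eventually_const_lt ha')
    obtain ⟨t, ht, htlt⟩ : ∃ t ∈ {t | 0 ≤ t ∧ VanishingError crit t C}, t < snr + δ := by
      by_contra! hcon
      have := hC.2 fun t ht => hcon t ht
      linarith
    have hhi : dist (max t snr) snr < δ := by
      rw [Real.dist_eq, abs_of_nonneg (by simp), sub_lt_iff_lt_add']
      exact max_lt htlt (by linarith)
    filter_upwards [eventually_lt_equivocation hN (ht.2.bit.mono ht.1 (le_max_left t snr))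
      (hball hhi)] with i hi
    refine lt_of_mul_lt_mul_right (hi.trans_le ?_) hlog.le
    gcongr
    exact equivocation_anti h0 (le_max_right t snr) (C i)
  · filter_upwards [hN.eventually_gt_atTop 0] with i hi
    have hi' : (0 : ℝ) < N i := by exact_mod_cast hi
    refine lt_of_le_of_lt ?_ ha
    rw [div_le_iff₀ hi', mul_comm]
    exact equivocation_le (C i) snr

end Wiretap

theorem theorem1 (crit : Wiretap.ErrorCriterion) (N : ℕ → ℕ) (hN : Tendsto N atTop atTop)
    (C₁ : (i : ℕ) → Wiretap.LinearCode (N i)) (R₁ thr : ℝ)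
    (hC₁ : Wiretap.IsGoodWithThreshold crit C₁ R₁ thr) (snr : ℝ) (hsnr : thr ≤ snr) :
    Wiretap.Achieves snr
        (fun i => (Wiretap.NestedPair.mk ⊤ (C₁ i) le_top).wiretapCode)
        (1 - R₁) (1 - Wiretap.capacityBIAWGN snr) ∧
      Wiretap.Achievable snr (1 - R₁) (1 - Wiretap.capacityBIAWGN snr) := by
  have h : Wiretap.Achieves snr
      (fun i => (Wiretap.NestedPair.mk ⊤ (C₁ i) le_top).wiretapCode)
      (1 - R₁) (1 - Wiretap.capacityBIAWGN snr) :=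
    { length := hN
      rate := by
        refine (hC₁.rate.const_sub 1).congr' ?_
        filter_upwards [hN.eventually_gt_atTop 0] with i hi
        exact (Wiretap.rate_eq hi (C₁ i)).symm
      reliable := by
        simp_rw [Wiretap.errorProb_eq_zero]
        exact tendsto_const_nhds
      equivocation := ⟨_, Wiretap.tendsto_equivocation hN hC₁.threshold hsnr, le_rfl⟩ }
  exact ⟨h, N, _, h⟩
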